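/- Let $\mathcal P$ be a finite set of participants and $\Sigma$ a finite alphabet. A channel is a pair $pq$ of distinct participants; the actions are $pq!a$ (send, with subject $p$) and $pq?a$ (receive, with subject $q$), for $a\in\Sigma$. A system $S=(M_p)_{p\in\mathcal P}$ consists of finite automata $M_p=(Q_p,q_{0p},\delta_p)$ whose transitions are labelled by actions with subject $p$. Each $M_p$ is assumed to be deterministic (two transitions from the same state with the same action have the same target) and without mixed states: every state that has an outgoing transition is either sending (all its outgoing transitions are sends) or receiving (all are receives). A configuration $s=(\vec q;\vec w)$ consists of a local state $q_p\in Q_p$ for each $p$ and a word $w_{pq}\in\Sigma^*$ for each channel; in the initial configuration $s_0$ all $q_p=q_{0p}$ and all $w_{pq}$ are empty. Firing $pq!a$ uses a transition $(q_p,pq!a,q_p')\in\delta_p$ and appends $a$ to the end of $w_{pq}$; firing $pq?a$ uses a transition $(q_q,pq?a,q_q')\in\delta_q$ and removes $a$ from the front of $w_{pq}$; nothing else changes. Write $s\xrightarrow{\phi}s'$ if the word of actions $\phi$ can be fired from $s$, leading to $s'$, and $s\xrightarrow{\phi}_k s'$ if this can be done so that in all configurations visited (including $s$ and $s'$) every channel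 contains at most $k$ messages; the target is omitted when only its existence matters. Let $RS(S)$ be the set of configurations $s$ with $s_0\xrightarrow{\phi}s$ for some $\phi$, and $RS_k(S)$ the set of those with $s_0\xrightarrow{\phi}_k s$ for some $\phi$. For an integer $k\ge 1$: - $S$ is $k$-OBI if for all $s=(\vec q;\vec w)\in RS_k(S)$ and all $p$: if $s\xrightarrow{pq!a}_k$ for some $q,a$, then $s\xrightarrow{pr!b}_k$ for every $(q_p,pr!b,q_p')\in\delta_p$. - $S$ is IBI if for all $s\in RS(S)$ and all $p$: if $s\xrightarrow{qp?a}$, then $qp?a$ is the only action with subject $p$ that can be fired from $s$. - $S$ is $k$-exhaustive if for all $s=(\vec q;\vec w)\in RS_k(S)$ and all $p$ such that $q_p$ is sending, and for every $(q_p,\ell,q_p')\in\delta_p$, there is a word $\phi$ containing no action with subject $p$ such that $s\xrightarrow{\phi}_k s'\xrightarrow{\ell}_k$ for some $s'$. - $S$ has the eventual reception property if for all $s=(\vec q;\vec w)\in RS(S)$ and all channels $pq$: if $w_{pq}$ begins with the message $a$, then $s\xrightarrow{\phi}s'\xrightarrow{pq?a}$ for some $\phi$ and $s'$. For a word $\phi$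 of actions let $\mathrm{snd}_{pq}(\phi)$ and $\mathrm{rcv}_{pq}(\phi)$ be the words of messages sent, respectively received, on $pq$ in $\phi$. The word $\phi$ is valid if $\mathrm{rcv}_{pq}(\psi)$ is a prefix of $\mathrm{snd}_{pq}(\psi)$ for every prefix $\psi$ of $\phi$ and every channel $pq$. It is $k$-match-bounded if it is valid and, for every prefix $\psi$ of $\phi$ and every channel $pq$, $$\min\{|\mathrm{snd}_{pq}(\psi)|,\,|\mathrm{rcv}_{pq}(\phi)|\}-|\mathrm{rcv}_{pq}(\psi)|\le k.$$ Two words are causally equivalent if both are valid and, for each participant $p$, they have the same subsequence of actions with subject $p$. $S$ is existentially $k$-bounded if every $\phi$ with $s_0\xrightarrow{\phi}s$ for some $s$ is causally equivalent to a $k$-match-bounded word. Theorem. Let $k\ge 1$. (1) If $S$ is $k$-OBI, IBI and $k$-exhaustive, then $S$ is existentially $k$-bounded. (2) If $S$ is existentially $k$-bounded and has the eventual reception property, then $S$ is $k$-exhaustive. -/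

import Mathlib

/-! Systems of communicating automata over unbounded or bounded FIFO channels. -/

namespace Communicating

/-- A channel `pq` between two distinct participants. -/
@[ext]
structure Channel (P : Type*) where
  src : P
  dst : P
  ne : src ≠ dst
  deriving DecidableEq

/-- Actions: `send c a` is `c!a` (emission) and `recv c a` is `c?a` (reception). -/
inductive Action (P A : Type*) where
  | send (c : Channel P) (a : A)
  | recv (c : Channel P) (a : A)

namespace Action

variable {P A : Type*}

/-- The participant that performs the action. -/
def subj : Action P A → P
  | send c _ => c.src
  | recv c _ => c.dst

def IsSend : Action P A → Prop
  | send _ _ => True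
  | recv _ _ => False

def IsRecv : Action P A → Prop
  | send _ _ => False
  | recv _ _ => True

end Action

/-- A communicating automaton with state set `Q`. (Finiteness of `Q` is asked for where
automata are quantified over.) -/
structure Automaton (P A Q : Type*) where
  init : Q
  trans : Q → Action P A → Q → Prop

namespace Automaton

variable {P A Q : Type*} (M : Automaton P A Q)

def Final (q : Q) : Prop := ∀ ℓ q', ¬ M.trans q ℓ q'

def Sending (q : Q) : Prop := ¬ M.Final q ∧ ∀ ℓ q', M.trans q ℓ q' → ℓ.IsSend

def Receiving (q : Q) : Prop := ¬ M.Final q ∧ ∀ ℓ q', M.trans q ℓ q' → ℓ.IsRecv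

def Mixed (q : Q) : Prop := ¬ M.Final q ∧ ¬ M.Sending q ∧ ¬ M.Receiving q

def Deterministic : Prop := ∀ q ℓ q' q'', M.trans q ℓ q' → M.trans q ℓ q'' → q' = q''

end Automaton

/-- A system: one automaton for each participant. -/
abbrev System (P A : Type*) (Q : P → Type*) := (p : P) → Automaton P A (Q p)

/-- A configuration: the local states and the contents of the channels
(the head of a list is the oldest message). -/
@[ext]
structure Config (P A : Type*) (Q : P → Type*) where
  st : (p : P) → Q p
  buf : Channel P → List A

namespace Config

variable {P A : Type*} {Q : P → Type*}

/-- `k`-boundedness of a configuration; `k = ⊤` means no bound. -/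
def Bounded (k : ℕ∞) (s : Config P A Q) : Prop := ∀ c, ((s.buf c).length : ℕ∞) ≤ k

theorem bounded_top (s : Config P A Q) : s.Bounded ⊤ := fun _ => le_top

end Config

namespace System

variable {P A : Type*} {Q : P → Type*} (S : System P A Q)

/-- Communicating session automata: every automaton is deterministic, has no mixed state,
and participant `p` performs only its own actions. -/
def IsCSA : Prop :=
  ∀ p, (S p).Deterministic ∧ (∀ q, ¬ (S p).Mixed q) ∧
    ∀ q ℓ q', (S p).trans q ℓ q' → ℓ.subj = p

/-- The initial configuration, with empty channels. -/
def initial : Config P A Q where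
  st p := (S p).init
  buf _ := []

/-- Firing one action. -/
inductive Step : Config P A Q → Action P A → Config P A Q → Prop
  | send {s s' : Config P A Q} (c : Channel P) (a : A)
      (htrans : (S c.src).trans (s.st c.src) (.send c a) (s'.st c.src))
      (hst : ∀ p, p ≠ c.src → s'.st p = s.st p)
      (hc : s'.buf c = s.buf c ++ [a])
      (hbuf : ∀ d, d ≠ c → s'.buf d = s.buf d) : Step s (.send c a) s'
  | recv {s s' : Config P A Q} (c : Channel P) (a : A)
      (htrans : (S c.dst).trans (s.st c.dst) (.recv c a) (s'.st c.dst))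
      (hst : ∀ p, p ≠ c.dst → s'.st p = s.st p)
      (hc : s.buf c = a :: s'.buf c)
      (hbuf : ∀ d, d ≠ c → s'.buf d = s.buf d) : Step s (.recv c a) s'

/-- `Exec k s φ s'`: the word `φ` leads from `s` to `s'`, and all the configurations that
are visited, `s` and `s'` included, are `k`-bounded. For `k = ⊤` these are all executions. -/
inductive Exec (k : ℕ∞) : Config P A Q → List (Action P A) → Config P A Q → Prop
  | nil {s : Config P A Q} (hs : s.Bounded k) : Exec k s [] s
  | cons {s t s' : Config P A Q} {ℓ : Action P A} {φ : List (Action P A)}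
      (hs : s.Bounded k) (hstep : S.Step s ℓ t) (htail : Exec k t φ s') : Exec k s (ℓ :: φ) s'

/-- The `k`-reachability set; for `k = ⊤`, the set of all reachable configurations. -/
def RS (k : ℕ∞) : Set (Config P A Q) := {s | ∃ φ, S.Exec k S.initial φ s}

/-- The action `ℓ` can be fired from `s` by a `k`-bounded execution. -/
def CanFire (k : ℕ∞) (s : Config P A Q) (ℓ : Action P A) : Prop := ∃ s', S.Exec k s [ℓ] s'

/-- `k`-output bound independence. -/
def OBI (k : ℕ∞) : Prop :=
  ∀ s ∈ S.RS k, ∀ p : P, ∀ (c : Channel P) (a : A), c.src = p →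
    S.CanFire k s (.send c a) →
    ∀ (d : Channel P) (b : A) (q' : Q p), d.src = p →
      (S p).trans (s.st p) (.send d b) q' → S.CanFire k s (.send d b)

/-- `k`-input bound independence; IBI (without a bound) is `IBI ⊤`. -/
def IBI (k : ℕ∞) : Prop :=
  ∀ s ∈ S.RS k, ∀ p : P, ∀ (c : Channel P) (a : A), c.dst = p →
    S.CanFire k s (.recv c a) →
    ∀ ℓ : Action P A, S.CanFire k s ℓ → ℓ.subj = p → ℓ = .recv c a

/-- `k`-exhaustivity. -/
def Exhaustive (k : ℕ∞) : Prop :=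
  ∀ s ∈ S.RS k, ∀ p : P, (S p).Sending (s.st p) →
    ∀ (ℓ : Action P A) (q' : Q p), (S p).trans (s.st p) ℓ q' →
      ∃ (φ : List (Action P A)) (s' : Config P A Q),
        S.Exec k s φ s' ∧ (∀ ℓ' ∈ φ, ℓ'.subj ≠ p) ∧ S.CanFire k s' ℓ

/-- Eventual reception within bound `k`; the (unbounded) eventual reception property is
`EventualReception ⊤`. -/
def EventualReception (k : ℕ∞) : Prop :=
  ∀ s ∈ S.RS k, ∀ (c : Channel P) (a : A) (w : List A), s.buf c = a :: w →
    ∃ (φ : List (Action P A)) (s' : Config P A Q),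
      S.Exec k s φ s' ∧ S.CanFire k s' (.recv c a)

end System

section Words

variable {P A : Type*} [DecidableEq P]

/-- The subsequence of the actions performed by `p`. -/
def proj (p : P) (φ : List (Action P A)) : List (Action P A) :=
  φ.filter fun ℓ => decide (ℓ.subj = p)

/-- The word of messages sent on the channel `c`. -/
def sent (c : Channel P) (φ : List (Action P A)) : List A :=
  φ.filterMap fun
    | .send d a => if d = c then some a else none
    | .recv _ _ => none

/-- The word of messages received on the channel `c`. -/
def received (c : Channel P) (φ : List (Action P A)) : List A :=
  φ.filterMap fun
    | .send _ _ => none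
    | .recv d a => if d = c then some a else none

/-- A word that respects the FIFO semantics of all channels. -/
def Valid (φ : List (Action P A)) : Prop :=
  ∀ ψ, ψ <+: φ → ∀ c, received c ψ <+: sent c ψ

/-- Causal equivalence of words. -/
def CausalEquiv (φ ψ : List (Action P A)) : Prop :=
  Valid φ ∧ Valid ψ ∧ ∀ p, proj p φ = proj p ψ

/-- `k`-match-boundedness: in every prefix `ψ`, on every channel, the number of sends that are
matched in `φ` exceeds the number of receptions by at most `k`. -/
def MatchBounded (k : ℕ) (φ : List (Action P A)) : Prop :=
  Valid φ ∧ ∀ ψ, ψ <+: φ → ∀ c,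
    ((min (sent c ψ).length (received c φ).length : ℕ) : ℤ) - ((received c ψ).length : ℤ) ≤ k

/-- An existentially `k`-bounded word. -/
def ExistBounded (k : ℕ) (φ : List (Action P A)) : Prop :=
  ∃ ψ, CausalEquiv φ ψ ∧ MatchBounded k ψ

/-- An existentially `k`-bounded system: all its executions, of whatever bound, are
existentially `k`-bounded. -/
def System.ExistBounded {Q : P → Type*} (S : System P A Q) (k : ℕ) : Prop :=
  ∀ (φ : List (Action P A)) (s : Config P A Q),
    S.Exec ⊤ S.initial φ s → Communicating.ExistBounded k φ

end Words

end Communicating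

namespace Communicating

/-! ### Projections, compatible words and meets. -/

section Words

variable {P A : Type*} [DecidableEq P]

/-! Words are compared participant by participant, by the prefix order on projections. By
determinism, a participant's local state depends only on its own projection, and a channel's content
only on those of its two ends. Hence an action stays enabled when other participants move ahead:
extra sends only append to a queue, extra receptions only free space (`Exec.fire_of_le`). So two
executions with comparable projections have a join, which is `k`-bounded if both are (`Exec.join`).

(1) Given an execution `φ`, a `k`-bounded execution compatible with `φ` is grown until it covers
`φ`. If the first uncovered action of `φ` is a reception, it can fire at once; if it is a send,
exhaustivity gives a `k`-bounded detour towards it. A detour that departs from the choices of `φ`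
does so at a send, since IBI and the absence of mixed states exclude the other cases; OBI then
allows the choice of `φ` instead (`compatible_or_canProgress`). Erasing from the covering execution
all that is not in `φ` leaves a match-bounded reordering of `φ` (`existBounded_of_le`).

(2) From a `k`-bounded `φ` and a send `ℓ` of `p`, fire `ℓ` ignoring the bound and continue fairly
along a chain `U`. Among the `k`-bounded extensions of `φ` below `U` without new actions of `p`,
take one that is maximal on each participant that cannot advance forever, and far enough on the
others. A match-bounded reordering of some `U (n + 1)` then supplies a first missing action. It is a
reception or a send matched in `U (n + 1)`, so it fires within `k`; by maximality it belongs to `p`,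
hence is `ℓ`. -/

theorem proj_append (p : P) (φ ψ : List (Action P A)) :
    proj p (φ ++ ψ) = proj p φ ++ proj p ψ := List.filter_append ..

theorem proj_mono {φ ψ : List (Action P A)} (h : φ <+: ψ) (p : P) : proj p φ <+: proj p ψ :=
  h.filter _

theorem proj_concat_self (φ : List (Action P A)) (e : Action P A) :
    proj e.subj (φ ++ [e]) = proj e.subj φ ++ [e] := by
  simp [proj]

theorem proj_concat_of_ne {p : P} (φ : List (Action P A)) {e : Action P A} (h : e.subj ≠ p) :
    proj p (φ ++ [e]) = proj p φ := by
  simp [proj, h]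

theorem sent_append (c : Channel P) (φ ψ : List (Action P A)) :
    sent c (φ ++ ψ) = sent c φ ++ sent c ψ := List.filterMap_append ..

theorem received_append (c : Channel P) (φ ψ : List (Action P A)) :
    received c (φ ++ ψ) = received c φ ++ received c ψ := List.filterMap_append ..

theorem sent_proj (c : Channel P) (φ : List (Action P A)) :
    sent c (proj c.src φ) = sent c φ := by
  unfold sent proj
  rw [List.filterMap_filter]
  congr 1
  funext e
  cases e with
  | send d a =>
    by_cases h : d = c
    · subst h; simp [Action.subj]
    · simp [h]
  | recv d a => simp

theorem received_proj (c : Channel P) (φ : List (Action P A)) :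
    received c (proj c.dst φ) = received c φ := by
  unfold received proj
  rw [List.filterMap_filter]
  congr 1
  funext e
  cases e with
  | recv d a =>
    by_cases h : d = c
    · subst h; simp [Action.subj]
    · simp [h]
  | send d a => simp

theorem sent_mono {c : Channel P} {φ ψ : List (Action P A)}
    (h : proj c.src φ <+: proj c.src ψ) : sent c φ <+: sent c ψ := by
  rw [← sent_proj c φ, ← sent_proj c ψ]
  exact h.filterMap _

theorem received_mono {c : Channel P} {φ ψ : List (Action P A)}
    (h : proj c.dst φ <+: proj c.dst ψ) : received c φ <+: received c ψ := by
  rw [← received_proj c φ, ← received_proj c ψ]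
  exact h.filterMap _

theorem sent_congr {c : Channel P} {φ ψ : List (Action P A)}
    (h : proj c.src φ = proj c.src ψ) : sent c φ = sent c ψ := by
  rw [← sent_proj c φ, h, sent_proj]

theorem received_congr {c : Channel P} {φ ψ : List (Action P A)}
    (h : proj c.dst φ = proj c.dst ψ) : received c φ = received c ψ := by
  rw [← received_proj c φ, h, received_proj]

theorem prefix_concat_cases {α : Type*} {l m : List α} {a : α} (h : l <+: m ++ [a]) :
    l = m ++ [a] ∨ l <+: m := by
  simpa [List.prefix_concat_iff] using h

/-- The projections of two words to each participant are comparable for the prefix order. -/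
def Compatible (φ ψ : List (Action P A)) : Prop :=
  ∀ p, proj p φ <+: proj p ψ ∨ proj p ψ <+: proj p φ

theorem Compatible.symm {φ ψ : List (Action P A)} (h : Compatible φ ψ) : Compatible ψ φ :=
  fun p => (h p).symm

theorem Compatible.of_le {φ φ' ψ : List (Action P A)} (h : Compatible φ ψ)
    (hφ : ∀ p, proj p φ' <+: proj p φ) : Compatible φ' ψ := fun p => by
  rcases h p with h | h
  · exact .inl ((hφ p).trans h)
  · exact List.prefix_or_prefix_of_prefix (hφ p) h

theorem compatible_of_le {φ ψ χ : List (Action P A)} (hφ : ∀ p, proj p φ <+: proj p χ)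
    (hψ : ∀ p, proj p ψ <+: proj p χ) : Compatible φ ψ :=
  fun p => List.prefix_or_prefix_of_prefix (hφ p) (hψ p)

theorem Compatible.concat {φ x : List (Action P A)} {e : Action P A} (h : Compatible x φ)
    (he : proj e.subj (x ++ [e]) <+: proj e.subj φ ∨
      proj e.subj φ <+: proj e.subj (x ++ [e])) : Compatible (x ++ [e]) φ := fun p => by
  by_cases hp : e.subj = p
  · subst hp; exact he
  · rw [proj_concat_of_ne _ hp]; exact h p

/-- Either all of `ψ` is below `x`, or there is a first action of `ψ` that is not. -/
theorem Compatible.le_or_exists_first {ψ x : List (Action P A)} (h : Compatible ψ x) :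
    (∀ p, proj p ψ <+: proj p x) ∨ ∃ ψ₁ e ψ₂, ψ = ψ₁ ++ e :: ψ₂ ∧
      (∀ p, proj p ψ₁ <+: proj p x) ∧ proj e.subj ψ₁ = proj e.subj x := by
  induction ψ using List.reverseRecOn with
  | nil => exact .inl fun p => List.nil_prefix
  | append_singleton ψ e ih =>
    rcases ih (h.of_le fun p => proj_mono (List.prefix_append ..) p) with hle | ⟨ψ₁, e', ψ₂, rfl, h₁⟩
    · have hcase := h e.subj
      rw [proj_concat_self] at hcase
      rcases hcase with he | he
      · left
        intro p
        by_cases hp : e.subj = p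
        · subst hp; rwa [proj_concat_self]
        · rw [proj_concat_of_ne _ hp]; exact hle p
      · rcases prefix_concat_cases he with he | he
        · left
          intro p
          by_cases hp : e.subj = p
          · subst hp; rw [proj_concat_self, he]
          · rw [proj_concat_of_ne _ hp]; exact hle p
        · exact .inr ⟨ψ, e, [], rfl, hle,
            (hle _).eq_of_length (le_antisymm (hle _).length_le he.length_le)⟩
    · exact .inr ⟨ψ₁, e', ψ₂ ++ [e], by simp, h₁⟩

/-- The first action of `p` in `φ` that lies beyond a strict prefix of its projection. -/
theorem exists_next_of_proj_prefix {p : P} {φ : List (Action P A)} {l : List (Action P A)}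
    (h : l <+: proj p φ) (hne : ¬ proj p φ <+: l) :
    ∃ φ₁ g φ₂, φ = φ₁ ++ g :: φ₂ ∧ proj p φ₁ = l ∧ g.subj = p := by
  obtain ⟨m, hm⟩ := h
  cases m with
  | nil => exact absurd (by simp [← hm]) hne
  | cons g m =>
    obtain ⟨φ₁, φ₂, rfl, h₁, h₂⟩ := List.filter_eq_append_iff.1 hm.symm
    obtain ⟨φ₃, φ₄, rfl, h₃, h₄, -⟩ := List.filter_eq_cons_iff.1 h₂
    refine ⟨φ₁ ++ φ₃, g, φ₄, by simp, ?_, by simpa using h₄⟩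
    rw [proj_append]
    have : proj p φ₃ = [] := List.filter_eq_nil_iff.2 h₃
    rw [this, List.append_nil]
    exact h₁

/-- On every participant, `ψ` is the meet of `φ` and `χ`. -/
def IsMeet (φ χ ψ : List (Action P A)) : Prop :=
  ∀ p, proj p ψ <+: proj p φ ∧ proj p ψ <+: proj p χ ∧
    (proj p ψ = proj p φ ∨ proj p ψ = proj p χ)

/-- The meet is `χ` with the actions beyond `φ` erased. The clause on prefixes lets validity and
bounds be read off at every moment of `χ`. -/
theorem exists_isMeet {φ χ : List (Action P A)} (h : Compatible χ φ) :
    ∃ ψ, IsMeet φ χ ψ ∧ ∀ ψ', ψ' <+: ψ → ∃ χ', χ' <+: χ ∧ IsMeet φ χ' ψ' := by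
  induction χ using List.reverseRecOn with
  | nil =>
    refine ⟨[], fun p => ⟨List.nil_prefix, List.nil_prefix, .inr rfl⟩, fun ψ' h' => ?_⟩
    rw [List.prefix_nil.1 h']
    exact ⟨[], List.nil_prefix, fun p => ⟨List.nil_prefix, List.nil_prefix, .inr rfl⟩⟩
  | append_singleton χ e ih =>
    obtain ⟨ψ, hψ, hpre⟩ := ih (h.of_le fun p => proj_mono (List.prefix_append ..) p)
    have hcase := h e.subj
    obtain ⟨h₁, h₂, h₃⟩ := hψ e.subj
    by_cases he : proj e.subj (χ ++ [e]) <+: proj e.subj φ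
    · have heq : proj e.subj ψ = proj e.subj χ := by
        rcases h₃ with h₃ | h₃
        · rw [h₃] at h₂
          have := he.length_le
          have := h₂.length_le
          rw [proj_concat_self] at *
          simp at *
          omega
        · exact h₃
      have hmeet : IsMeet φ (χ ++ [e]) (ψ ++ [e]) := by
        intro p
        by_cases hp : e.subj = p
        · subst hp
          have : proj e.subj (ψ ++ [e]) = proj e.subj (χ ++ [e]) := by
            rw [proj_concat_self, proj_concat_self, heq]
          rw [this]
          exact ⟨he, List.prefix_rfl, .inr rfl⟩
        · rw [proj_concat_of_ne _ hp, proj_concat_of_ne _ hp]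
          exact hψ p
      refine ⟨ψ ++ [e], hmeet, fun ψ' h' => ?_⟩
      rcases prefix_concat_cases h' with rfl | h'
      · exact ⟨_, List.prefix_rfl, hmeet⟩
      · obtain ⟨χ', hχ', hm⟩ := hpre ψ' h'
        exact ⟨χ', hχ'.trans (List.prefix_append ..), hm⟩
    · have heφ := hcase.resolve_left he
      have hle : proj e.subj φ <+: proj e.subj χ := by
        rw [proj_concat_self] at heφ he
        rcases prefix_concat_cases heφ with heφ | heφ
        · exact absurd (heφ ▸ List.prefix_rfl) he
        · exact heφ
      have heq : proj e.subj ψ = proj e.subj φ := by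
        rcases h₃ with h₃ | h₃
        · exact h₃
        · rw [h₃] at h₁ ⊢
          exact h₁.eq_of_length (le_antisymm h₁.length_le hle.length_le)
      refine ⟨ψ, fun p => ?_, fun ψ' h' => ?_⟩
      · by_cases hp : e.subj = p
        · subst hp
          exact ⟨h₁, h₂.trans (proj_mono (List.prefix_append ..) _), .inl heq⟩
        · rw [proj_concat_of_ne _ hp]
          exact hψ p
      · obtain ⟨χ', hχ', hm⟩ := hpre ψ' h'
        exact ⟨χ', hχ'.trans (List.prefix_append ..), hm⟩

/-- A word that can be completed to a `k`-bounded one is existentially `k`-bounded. -/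
theorem existBounded_of_le {k : ℕ} {φ χ : List (Action P A)} (hφ : Valid φ) (hχ : Valid χ)
    (hbd : ∀ χ', χ' <+: χ → ∀ c, (sent c χ').length ≤ (received c χ').length + k)
    (hle : ∀ p, proj p φ <+: proj p χ) : ExistBounded k φ := by
  obtain ⟨ψ, hψ, hpre⟩ := exists_isMeet (φ := φ) (χ := χ) fun p => .inr (hle p)
  have heq : ∀ p, proj p ψ = proj p φ := fun p => by
    obtain ⟨h₁, h₂, h₃ | h₃⟩ := hψ p
    · exact h₃
    · rw [h₃] at h₁ ⊢
      exact h₁.eq_of_length (le_antisymm h₁.length_le (hle p).length_le)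
  have hvalid : Valid ψ := by
    intro ψ' h' c
    obtain ⟨χ', hχ', hm⟩ := hpre ψ' h'
    have hr := hm c.dst
    rcases (hm c.src).2.2 with hs | hs
    · rw [sent_congr hs]
      exact (received_mono hr.1).trans (hφ φ List.prefix_rfl c)
    · rw [sent_congr hs]
      exact (received_mono hr.2.1).trans (hχ χ' hχ' c)
  refine ⟨ψ, ⟨hφ, hvalid, fun p => (heq p).symm⟩, hvalid, fun ψ' h' c => ?_⟩
  obtain ⟨χ', hχ', hm⟩ := hpre ψ' h'
  have hs := (sent_mono (hm c.src).2.1).length_le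
  -- If the receiver has finished its part of `φ`, no matched message is pending. Otherwise it has
  -- received as much as in `χ'`, whose bound applies.
  rcases (hm c.dst).2.2 with hr | hr
  · rw [received_congr (heq c.dst), received_congr hr]
    omega
  · rw [received_congr hr]
    have := hbd χ' hχ' c
    omega

end Words

/-! ### Executions, determinism and joins. -/

namespace System

variable {P A : Type*} {Q : P → Type*} {S : System P A Q} {k : ℕ∞}

theorem Exec.bounded_left {s t : Config P A Q} {φ : List (Action P A)} (h : S.Exec k s φ t) :
    s.Bounded k := by
  cases h <;> assumption

theorem Exec.bounded_right {s t : Config P A Q} {φ : List (Action P A)} (h : S.Exec k s φ t) :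
    t.Bounded k := by
  induction h <;> assumption

theorem Exec.mono {s t : Config P A Q} {φ : List (Action P A)} (h : S.Exec k s φ t) :
    S.Exec ⊤ s φ t := by
  induction h with
  | nil => exact .nil (Config.bounded_top _)
  | cons _ hstep _ ih => exact .cons (Config.bounded_top _) hstep ih

theorem exec_append {s t : Config P A Q} {φ ψ : List (Action P A)} :
    S.Exec k s (φ ++ ψ) t ↔ ∃ u, S.Exec k s φ u ∧ S.Exec k u ψ t := by
  constructor
  · induction φ generalizing s with
    | nil => exact fun h => ⟨s, .nil h.bounded_left, h⟩
    | cons e φ ih =>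
      intro h
      cases h with
      | cons hs hstep htail =>
        obtain ⟨u, h₁, h₂⟩ := ih htail
        exact ⟨u, .cons hs hstep h₁, h₂⟩
  · rintro ⟨u, h₁, h₂⟩
    induction h₁ with
    | nil => exact h₂
    | cons hs hstep _ ih => exact .cons hs hstep (ih h₂)

theorem exec_singleton {s t : Config P A Q} {e : Action P A} :
    S.Exec k s [e] t ↔ s.Bounded k ∧ S.Step s e t ∧ t.Bounded k := by
  constructor
  · intro h
    cases h with
    | cons hs hstep htail =>
      cases htail with
      | nil ht => exact ⟨hs, hstep, ht⟩
  · rintro ⟨hs, hstep, ht⟩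
    exact .cons hs hstep (.nil ht)

theorem exec_initial_nil : S.Exec k S.initial [] S.initial :=
  .nil fun c => by simp [initial]

theorem Exec.trans_of_concat {s t : Config P A Q} {φ : List (Action P A)} {e : Action P A}
    (h : S.Exec k s (φ ++ [e]) t) :
    ∃ u, S.Exec k s φ u ∧ (S e.subj).trans (u.st e.subj) e (t.st e.subj) ∧
      ∀ p, e.subj ≠ p → t.st p = u.st p := by
  obtain ⟨u, h₁, h₂⟩ := exec_append.1 h
  obtain ⟨-, hstep, -⟩ := exec_singleton.1 h₂
  refine ⟨u, h₁, ?_⟩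
  cases hstep with
  | send c a htrans hst _ _ => exact ⟨htrans, fun p hp => hst p hp.symm⟩
  | recv c a htrans hst _ _ => exact ⟨htrans, fun p hp => hst p hp.symm⟩

theorem Exec.of_prefix {s t : Config P A Q} {φ ψ : List (Action P A)}
    (h : S.Exec k s φ t) (hψ : ψ <+: φ) : ∃ u, S.Exec k s ψ u := by
  obtain ⟨χ, rfl⟩ := hψ
  obtain ⟨u, h, -⟩ := exec_append.1 h
  exact ⟨u, h⟩

theorem Exec.concat {s t u : Config P A Q} {φ ψ : List (Action P A)} (h : S.Exec k s φ t)
    (h' : S.Exec k t ψ u) : S.Exec k s (φ ++ ψ) u :=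
  exec_append.2 ⟨t, h, h'⟩

variable [DecidableEq P]

theorem Exec.sent_eq {s : Config P A Q} {φ : List (Action P A)}
    (h : S.Exec k S.initial φ s) (c : Channel P) : sent c φ = received c φ ++ s.buf c := by
  induction φ using List.reverseRecOn generalizing s with
  | nil =>
    cases h
    simp [sent, received, initial]
  | append_singleton φ e ih =>
    obtain ⟨u, h₁, h₂⟩ := exec_append.1 h
    obtain ⟨-, hstep, -⟩ := exec_singleton.1 h₂
    rw [sent_append, received_append, ih h₁]
    cases hstep with
    | send d a _ _ hc hbuf =>
      by_cases hd : d = c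
      · subst hd; simp [sent, received, hc]
      · simp [sent, received, hd, hbuf c (Ne.symm hd)]
    | recv d a _ _ hc hbuf =>
      by_cases hd : d = c
      · subst hd; simp [sent, received, hc]
      · simp [sent, received, hd, hbuf c (Ne.symm hd)]

theorem Exec.valid {s : Config P A Q} {φ : List (Action P A)}
    (h : S.Exec k S.initial φ s) : Valid φ := fun ψ hψ c => by
  obtain ⟨u, hu⟩ := h.of_prefix hψ
  exact ⟨_, (hu.sent_eq c).symm⟩

theorem Exec.length_sent {s : Config P A Q} {φ : List (Action P A)}
    (h : S.Exec k S.initial φ s) (c : Channel P) :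
    (sent c φ).length = (received c φ).length + (s.buf c).length := by
  rw [h.sent_eq c, List.length_append]

theorem Exec.length_sent_le {s : Config P A Q} {φ : List (Action P A)}
    (h : S.Exec k S.initial φ s) (c : Channel P) :
    ((sent c φ).length : ℕ∞) ≤ (received c φ).length + k := by
  rw [h.length_sent c]
  push_cast
  gcongr
  exact h.bounded_right c

/-- Actions of other participants leave the state of `p` unchanged and can be stripped from the end
of either word; the remaining actions of `p` are matched by determinism. -/
theorem st_eq_of_proj_eq (hS : S.IsCSA) {k' : ℕ∞} {s t : Config P A Q}
    {φ ψ : List (Action P A)} {p : P} (hφ : S.Exec k S.initial φ s)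
    (hψ : S.Exec k' S.initial ψ t) (h : proj p φ = proj p ψ) : s.st p = t.st p := by
  induction ψ using List.reverseRecOn generalizing φ s t with
  | nil =>
    induction φ using List.reverseRecOn generalizing s with
    | nil => cases hφ; cases hψ; rfl
    | append_singleton φ e ih =>
      obtain ⟨u, hu, -, hst⟩ := hφ.trans_of_concat
      by_cases he : e.subj = p
      · subst he; rw [proj_concat_self] at h; simp [proj] at h
      · rw [hst p he]
        exact ih hu (by rwa [proj_concat_of_ne _ he] at h)
  | append_singleton ψ f ihψ =>
    obtain ⟨v, hv, htr, hstv⟩ := hψ.trans_of_concat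
    by_cases hf : f.subj = p
    · subst hf
      induction φ using List.reverseRecOn generalizing s with
      | nil => rw [proj_concat_self] at h; simp [proj] at h
      | append_singleton φ e ih =>
        obtain ⟨u, hu, htr', hst⟩ := hφ.trans_of_concat
        by_cases he : e.subj = f.subj
        · have h' := proj_concat_self φ e
          rw [he] at h'
          rw [proj_concat_self, h'] at h
          obtain ⟨h₁, h₂⟩ := List.append_inj' h rfl
          obtain rfl : e = f := by simpa using h₂
          rw [ihψ hu hv h₁] at htr'
          exact (hS _).1 _ _ _ _ htr' htr
        · rw [hst _ he]
          exact ih hu (by rwa [proj_concat_of_ne _ he] at h)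
    · rw [hstv p hf]
      exact ihψ hφ hv (by rwa [proj_concat_of_ne _ hf] at h)

theorem exists_trans_of_proj_prefix (hS : S.IsCSA) {k' : ℕ∞} {s t : Config P A Q}
    {φ ψ : List (Action P A)} {p : P} (hφ : S.Exec k S.initial φ s)
    (hψ : S.Exec k' S.initial ψ t) {e : Action P A} (he : proj p φ ++ [e] <+: proj p ψ) :
    ∃ q, (S p).trans (s.st p) e q := by
  obtain ⟨ψ₁, g, ψ₂, rfl, h₁, rfl⟩ := exists_next_of_proj_prefix
    ((List.prefix_append ..).trans he) fun h' => by
      have := (he.trans h').length_le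
      simp at this
  obtain rfl : e = g := by
    have : proj g.subj (ψ₁ ++ g :: ψ₂) = proj g.subj φ ++ g :: proj g.subj ψ₂ := by
      rw [proj_append, h₁]; simp [proj]
    rw [this, List.prefix_append_right_inj] at he
    simpa using he
  obtain ⟨w, hw⟩ := hψ.of_prefix (ψ := ψ₁ ++ [e]) ⟨ψ₂, by simp⟩
  obtain ⟨v, hv, htr, -⟩ := hw.trans_of_concat
  rw [st_eq_of_proj_eq hS hφ hv h₁.symm]
  exact ⟨_, htr⟩

theorem Exec.unique (hS : S.IsCSA) {s t : Config P A Q} {φ : List (Action P A)}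
    (hs : S.Exec k S.initial φ s) (ht : S.Exec k S.initial φ t) : s = t := by
  ext c
  · exact st_eq_of_proj_eq hS hs ht rfl
  · have h := (hs.sent_eq c).symm.trans (ht.sent_eq c)
    rw [List.append_cancel_left h]

theorem Exec.fire_recv {s : Config P A Q} {x : List (Action P A)} (hx : S.Exec k S.initial x s)
    {c : Channel P} {a : A} {q : Q c.dst} (htr : (S c.dst).trans (s.st c.dst) (.recv c a) q)
    {w : List A} (hw : s.buf c = a :: w) : ∃ t, S.Exec k s [.recv c a] t := by
  have hs := hx.bounded_right
  refine ⟨⟨Function.update s.st c.dst q, Function.update s.buf c w⟩,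
    exec_singleton.2 ⟨hs, .recv c a ?_ ?_ ?_ ?_, fun d => ?_⟩⟩
  · simpa using htr
  · intro p hp; simp [hp]
  · simpa using hw
  · intro d hd; simp [hd]
  · by_cases hd : d = c
    · subst hd
      refine le_trans ?_ (hs d)
      simp [hw]
    · simpa [hd] using hs d

theorem Exec.fire_send {s : Config P A Q} {x : List (Action P A)} (hx : S.Exec k S.initial x s)
    {c : Channel P} {a : A} {q : Q c.src} (htr : (S c.src).trans (s.st c.src) (.send c a) q)
    (hk : ((s.buf c).length : ℕ∞) + 1 ≤ k) : ∃ t, S.Exec k s [.send c a] t := by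
  have hs := hx.bounded_right
  refine ⟨⟨Function.update s.st c.src q, Function.update s.buf c (s.buf c ++ [a])⟩,
    exec_singleton.2 ⟨hs, .send c a ?_ ?_ ?_ ?_, fun d => ?_⟩⟩
  · simpa using htr
  · intro p hp; simp [hp]
  · simp
  · intro d hd; simp [hd]
  · by_cases hd : d = c
    · subst hd
      simpa using hk
    · simpa [hd] using hs d

/-- An action that is enabled after `ψ` is enabled after any `x` above `ψ` in which its subject
has done the same, if the bound allows it. -/
theorem Exec.fire_of_le (hS : S.IsCSA) {k' : ℕ∞} {s t : Config P A Q}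
    {x ψ : List (Action P A)} {e : Action P A} (hx : S.Exec k S.initial x s)
    (hψ : S.Exec k' S.initial (ψ ++ [e]) t) (hle : ∀ p, proj p ψ <+: proj p x)
    (heq : proj e.subj ψ = proj e.subj x)
    (hk : ∀ c a, e = .send c a → ((sent c ψ).length : ℕ∞) + 1 ≤ (received c ψ).length + k) :
    ∃ t', S.Exec k s [e] t' := by
  obtain ⟨u, hu, htr, -⟩ := hψ.trans_of_concat
  rw [← st_eq_of_proj_eq hS hx hu heq.symm] at htr
  have hval := hψ.valid _ List.prefix_rfl
  cases e with
  | send c a =>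
    refine hx.fire_send htr ?_
    have h₁ := hk c a rfl
    have h₂ : sent c ψ = sent c x := sent_congr heq
    have h₃ := (received_mono (hle c.dst)).length_le
    have h₄ := hx.length_sent c
    rw [h₂] at h₁
    cases k with
    | top => exact le_top
    | coe k => norm_cast at *; omega
  | recv c a =>
    have h₁ := hval c
    have h₂ : received c ψ = received c x := received_congr heq
    rw [received_append, sent_append, h₂] at h₁
    have h₃ : received c x ++ [a] <+: received c x ++ s.buf c := by
      rw [← hx.sent_eq c]
      refine List.IsPrefix.trans ?_ (sent_mono (hle c.src))
      simpa [sent, received] using h₁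
    rw [List.prefix_append_right_inj] at h₃
    obtain ⟨w, hw⟩ := h₃
    exact hx.fire_recv htr hw.symm

/-- Two executions that agree on all local choices have an upper bound that extends the first. -/
theorem Exec.join (hS : S.IsCSA) {s t : Config P A Q} {x y : List (Action P A)}
    (hx : S.Exec k S.initial x s) (hy : S.Exec k S.initial y t) (h : Compatible x y) :
    ∃ z u, S.Exec k S.initial z u ∧ x <+: z ∧ ∀ p, proj p y <+: proj p z ∧
      (proj p z = proj p x ∨ proj p z = proj p y) := by
  induction y using List.reverseRecOn generalizing t with
  | nil => exact ⟨x, s, hx, List.prefix_rfl, fun p => ⟨List.nil_prefix, .inl rfl⟩⟩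
  | append_singleton y e ih =>
    obtain ⟨v, hv, -⟩ := hy.trans_of_concat
    have hyy : ∀ p, proj p y <+: proj p (y ++ [e]) := proj_mono (List.prefix_append ..)
    obtain ⟨z, u, hz, hxz, hz'⟩ := ih hv (h.symm.of_le hyy).symm
    have hxz' := proj_mono hxz
    -- Either `e` already occurs in `x`, or its subject has done in `z` exactly what it did in `y`,
    -- so that `e` can be appended.
    by_cases hcov : proj e.subj (y ++ [e]) <+: proj e.subj x
    · refine ⟨z, u, hz, hxz, fun p => ?_⟩
      by_cases hp : e.subj = p
      · subst hp
        refine ⟨hcov.trans (hxz' _), .inl ?_⟩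
        rcases (hz' e.subj).2 with h' | h'
        · exact h'
        · exact ((hxz' _).eq_of_length
            (le_antisymm (hxz' _).length_le (h' ▸ ((hyy _).trans hcov).length_le))).symm
      · rw [proj_concat_of_ne _ hp]; exact hz' p
    · have hxe : proj e.subj x <+: proj e.subj y := by
        rcases h e.subj with h' | h'
        · rw [proj_concat_self] at h' hcov
          rcases prefix_concat_cases h' with h' | h'
          · exact absurd (h' ▸ List.prefix_rfl) hcov
          · exact h'
        · exact absurd h' hcov
      have heq : proj e.subj y = proj e.subj z := by
        rcases (hz' e.subj).2 with h' | h'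
        · exact (hz' e.subj).1.eq_of_length
            (le_antisymm (hz' e.subj).1.length_le (h' ▸ hxe.length_le))
        · exact h'.symm
      obtain ⟨t', ht'⟩ := hz.fire_of_le hS hy (fun p => (hz' p).1) heq fun c a he => by
        subst he
        have := hy.length_sent_le c
        simpa [sent, received] using this
      refine ⟨z ++ [e], t', hz.concat ht', hxz.trans (List.prefix_append ..), fun p => ?_⟩
      by_cases hp : e.subj = p
      · subst hp
        rw [proj_concat_self, proj_concat_self, heq]
        exact ⟨List.prefix_rfl, .inr rfl⟩
      · rw [proj_concat_of_ne _ hp, proj_concat_of_ne _ hp]; exact hz' p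

/-- The local transitions are those taken along `φ`; validity puts the right message at the head of
the queue. This makes causally equivalent reorderings executable. -/
theorem Exec.of_valid (hS : S.IsCSA) {s : Config P A Q} {φ ψ : List (Action P A)}
    (hφ : S.Exec ⊤ S.initial φ s) (hψ : Valid ψ) (hle : ∀ p, proj p ψ <+: proj p φ) :
    ∃ t, S.Exec ⊤ S.initial ψ t := by
  induction ψ using List.reverseRecOn with
  | nil => exact ⟨_, exec_initial_nil⟩
  | append_singleton ψ e ih =>
    have hle' : ∀ p, proj p ψ <+: proj p φ :=
      fun p => (proj_mono (List.prefix_append ..) p).trans (hle p)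
    obtain ⟨t, ht⟩ := ih (fun χ hχ => hψ χ (hχ.trans (List.prefix_append ..))) hle'
    obtain ⟨q, hq⟩ := exists_trans_of_proj_prefix hS ht hφ (e := e)
      (by rw [← proj_concat_self]; exact hle _)
    suffices ∃ t', S.Exec ⊤ t [e] t' by
      obtain ⟨t', ht'⟩ := this
      exact ⟨t', ht.concat ht'⟩
    cases e with
    | send c a => exact ht.fire_send hq le_top
    | recv c a =>
      have h₁ := hψ _ List.prefix_rfl c
      have h₂ : received c ψ ++ [a] <+: sent c ψ := by
        simpa [sent, received] using h₁
      rw [ht.sent_eq c, List.prefix_append_right_inj] at h₂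
      obtain ⟨w, hw⟩ := h₂
      exact ht.fire_recv hq hw.symm

/-! ### Part (1): covering an execution by a `k`-bounded one. -/

variable (S) in
/-- Some `k`-bounded execution above `x` is compatible with `φ` and covers more of `φ`. -/
def CanProgress (k : ℕ∞) (φ x : List (Action P A)) : Prop :=
  ∃ y t, S.Exec k S.initial y t ∧ Compatible y φ ∧ (∀ p, proj p x <+: proj p y) ∧
    ∃ p, (proj p x).length < (proj p y).length ∧ (proj p x).length < (proj p φ).length

theorem canProgress_of_fire {k : ℕ∞} {s t : Config P A Q} {φ x φ₁ φ₂ : List (Action P A)}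
    {e : Action P A} (hx : S.Exec k S.initial x s) (hφ : φ = φ₁ ++ e :: φ₂)
    (heq : proj e.subj φ₁ = proj e.subj x) (hc : Compatible x φ) (he : S.Exec k s [e] t) :
    S.CanProgress k φ x := by
  have h : proj e.subj (x ++ [e]) <+: proj e.subj φ := by
    rw [proj_concat_self, ← heq, ← proj_concat_self]
    exact proj_mono ⟨φ₂, by simp [hφ]⟩ _
  refine ⟨x ++ [e], t, hx.concat he, hc.concat (.inl h),
    proj_mono (List.prefix_append ..), e.subj, by simp [proj_concat_self], ?_⟩
  have := h.length_le
  rw [proj_concat_self, List.length_append] at this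
  simpa using this

/-- Only a conflict between `f` and the next action `g` of the same participant in `φ` matters. A
reception `f` would be enabled together with `g` at a join, against IBI; for a send `f`, OBI lets
`g` fire in its place. -/
theorem compatible_or_canProgress (hS : S.IsCSA) {k : ℕ∞} (hO : S.OBI k) (hI : S.IBI ⊤)
    {r s t : Config P A Q} {φ x : List (Action P A)} (hφ : S.Exec ⊤ S.initial φ r)
    (hx : S.Exec k S.initial x s) (hc : Compatible x φ) {f : Action P A}
    (hf : S.Exec k s [f] t) : Compatible (x ++ [f]) φ ∨ S.CanProgress k φ x := by
  by_cases hcov : proj f.subj φ <+: proj f.subj x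
  · exact .inl (hc.concat (.inr (hcov.trans (proj_mono (List.prefix_append ..) _))))
  obtain ⟨φ₁, g, φ₂, rfl, heq, hg⟩ :=
    exists_next_of_proj_prefix ((hc f.subj).resolve_right hcov) hcov
  obtain ⟨r', hr'⟩ := hφ.of_prefix (ψ := φ₁ ++ [g]) ⟨φ₂, by simp⟩
  obtain ⟨r₁, hr₁, htr, -⟩ := hr'.trans_of_concat
  by_cases hfg : f = g
  · subst hfg
    refine .inl (hc.concat (.inl ?_))
    rw [proj_concat_self, ← heq, ← proj_concat_self]
    exact proj_mono ⟨φ₂, by simp⟩ _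
  have hst : r₁.st f.subj = s.st f.subj := st_eq_of_proj_eq hS hr₁ hx heq
  obtain ⟨s', hs', htrf, -⟩ := (hx.concat hf).trans_of_concat
  obtain rfl := hs'.unique hS hx
  cases f with
  | recv c a =>
    exfalso
    -- The prefix `φ₁` need not be `k`-bounded, so the join is taken without a bound; this is why
    -- IBI is needed on all reachable configurations.
    obtain ⟨z, u, hz, hxz, hyz⟩ := hx.mono.join hS hr₁
      (hc.symm.of_le (proj_mono ⟨g :: φ₂, rfl⟩)).symm
    have hzx : proj c.dst z = proj c.dst x := by
      rcases (hyz c.dst).2 with h | h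
      · exact h
      · exact h.trans heq
    obtain ⟨v, hv⟩ := hz.fire_of_le hS (hx.concat hf) (proj_mono hxz) hzx.symm
      (fun c a h => by cases h)
    obtain ⟨w, hw⟩ := hz.fire_of_le hS hr' (fun p => (hyz p).1)
      (by rw [hg]; exact heq.trans hzx.symm) (fun c a h => by simp)
    exact hfg (hI u ⟨z, hz⟩ c.dst c a rfl ⟨v, hv⟩ g ⟨w, hw⟩ hg).symm
  | send c a =>
    cases g with
    | recv d b =>
      exfalso
      have htr' : (S d.dst).trans (s'.st d.dst) (.recv d b) _ :=
        (show r₁.st d.dst = s'.st d.dst by rw [show d.dst = c.src from hg]; exact hst) ▸ htr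
      have htrf' : ∃ q, (S d.dst).trans (s'.st d.dst) (.send c a) q := by
        rw [show d.dst = c.src from hg]; exact ⟨_, htrf⟩
      obtain ⟨q, hq⟩ := htrf'
      exact (hS d.dst).2.1 (s'.st d.dst) ⟨fun h => h _ _ hq, fun h => h.2 _ _ htr',
        fun h => h.2 _ _ hq⟩
    | send d b =>
      have hg' : d.src = c.src := hg
      have htr' : ∃ q, (S c.src).trans (s'.st c.src) (.send d b) q := by
        have : r₁.st c.src = s'.st c.src := hst
        rw [← this, ← hg']
        exact ⟨_, htr⟩
      obtain ⟨q, hq⟩ := htr'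
      obtain ⟨v, hv⟩ := hO s' ⟨x, hx⟩ c.src c a rfl ⟨t, hf⟩ d b q hg' hq
      exact .inr (canProgress_of_fire hx rfl (by rw [hg]; exact heq) hc hv)

theorem compatible_append_or_canProgress (hS : S.IsCSA) {k : ℕ∞} (hO : S.OBI k) (hI : S.IBI ⊤)
    {r s t : Config P A Q} {φ x w : List (Action P A)} (hφ : S.Exec ⊤ S.initial φ r)
    (hx : S.Exec k S.initial x s) (hc : Compatible x φ) (hw : S.Exec k s w t) :
    Compatible (x ++ w) φ ∨ S.CanProgress k φ x := by
  induction w using List.reverseRecOn generalizing t with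
  | nil => simpa using .inl hc
  | append_singleton w f ih =>
    obtain ⟨u, hu, hf⟩ := exec_append.1 hw
    rcases ih hu with h | h
    · rcases compatible_or_canProgress hS hO hI hφ (hx.concat hu) h hf with h | h
      · exact .inl (by simpa using h)
      · obtain ⟨y, v, hy, hyc, hle, p, h₁, h₂⟩ := h
        have hxw : ∀ p, proj p x <+: proj p (x ++ w) := proj_mono (List.prefix_append ..)
        have := (hxw p).length_le
        exact .inr ⟨y, v, hy, hyc, fun q => (hxw q).trans (hle q), p, by omega, by omega⟩
    · exact .inr h

theorem covered_or_canProgress (hS : S.IsCSA) {k : ℕ∞} (hO : S.OBI k) (hI : S.IBI ⊤)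
    (hE : S.Exhaustive k) {r s : Config P A Q} {φ x : List (Action P A)}
    (hφ : S.Exec ⊤ S.initial φ r) (hx : S.Exec k S.initial x s) (hc : Compatible x φ) :
    (∀ p, proj p φ <+: proj p x) ∨ S.CanProgress k φ x := by
  rcases hc.symm.le_or_exists_first with h | ⟨φ₁, e, φ₂, rfl, hle, heq⟩
  · exact .inl h
  right
  obtain ⟨r', hr'⟩ := hφ.of_prefix (ψ := φ₁ ++ [e]) ⟨φ₂, by simp⟩
  obtain ⟨r₁, hr₁, htr, -⟩ := hr'.trans_of_concat
  have hst := st_eq_of_proj_eq hS hr₁ hx heq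
  cases e with
  | recv c a =>
    obtain ⟨t, ht⟩ := hx.fire_of_le hS hr' hle heq (fun c a h => by cases h)
    exact canProgress_of_fire hx rfl heq hc ht
  | send c a =>
    rw [hst] at htr
    have hsend : (S c.src).Sending (s.st c.src) := by
      by_contra hns
      exact (hS c.src).2.1 (s.st c.src) ⟨fun h => h _ _ htr, hns, fun h => h.2 _ _ htr⟩
    obtain ⟨w, s', hw, -, t, ht⟩ := hE s ⟨x, hx⟩ c.src hsend _ _ htr
    -- The detour and the send are appended together: if compatibility survives, the send itself is
    -- the progress.
    rcases compatible_append_or_canProgress hS hO hI hφ hx hc (hw.concat ht) with h | h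
    · refine ⟨_, t, hx.concat (hw.concat ht), h, proj_mono (List.prefix_append ..), c.src, ?_, ?_⟩
      · simp [proj, Action.subj]
      · rw [← show proj c.src φ₁ = proj c.src x from heq]
        simp [proj, Action.subj]
    · exact h

theorem exists_covering [Finite P] (hS : S.IsCSA) {k : ℕ∞} (hO : S.OBI k) (hI : S.IBI ⊤)
    (hE : S.Exhaustive k) {r : Config P A Q} {φ : List (Action P A)}
    (hφ : S.Exec ⊤ S.initial φ r) :
    ∃ x s, S.Exec k S.initial x s ∧ ∀ p, proj p φ <+: proj p x := by
  have := Fintype.ofFinite P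
  -- The measure counts the uncovered actions of `φ`; truncated subtraction gives zero for
  -- participants already beyond `φ`.
  suffices H : ∀ (n : ℕ) x s, S.Exec k S.initial x s → Compatible x φ →
      ∑ p, ((proj p φ).length - (proj p x).length) ≤ n →
      ∃ x s, S.Exec k S.initial x s ∧ ∀ p, proj p φ <+: proj p x from
    H _ [] _ exec_initial_nil (fun p => .inl List.nil_prefix) le_rfl
  intro n
  induction n with
  | zero =>
    intro x s hx hc hn
    rcases covered_or_canProgress hS hO hI hE hφ hx hc with h | ⟨y, t, -, -, -, p, -, h₂⟩
    · exact ⟨x, s, hx, h⟩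
    · have := Finset.sum_eq_zero_iff.1 (Nat.le_zero.1 hn) p (Finset.mem_univ p)
      omega
  | succ n ih =>
    intro x s hx hc hn
    rcases covered_or_canProgress hS hO hI hE hφ hx hc with h | ⟨y, t, hy, hyc, hle, p, h₁, h₂⟩
    · exact ⟨x, s, hx, h⟩
    · refine ih y t hy hyc (Nat.le_of_lt_succ (lt_of_lt_of_le ?_ hn))
      refine Finset.sum_lt_sum (fun q _ => ?_) ⟨p, Finset.mem_univ p, by omega⟩
      have := (hle q).length_le
      omega

theorem existBounded_of_exhaustive [Finite P] (hS : S.IsCSA) {k : ℕ} (hO : S.OBI k)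
    (hI : S.IBI ⊤) (hE : S.Exhaustive k) : S.ExistBounded k := fun φ r hφ => by
  obtain ⟨x, s, hx, hle⟩ := exists_covering hS hO hI hE hφ
  refine existBounded_of_le hφ.valid hx.valid (fun χ' hχ' c => ?_) hle
  obtain ⟨u, hu⟩ := hx.of_prefix hχ'
  exact_mod_cast hu.length_sent_le c

/-! ### Part (2): fair continuations and maximal `k`-bounded words. -/

theorem exists_received_ge (hE : S.EventualReception ⊤) {t : Config P A Q}
    {φ : List (Action P A)} (hφ : S.Exec ⊤ S.initial φ t) (c : Channel P) :
    ∀ n ≤ (sent c φ).length, ∃ ψ u, φ <+: ψ ∧ S.Exec ⊤ S.initial ψ u ∧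
      n ≤ (received c ψ).length := by
  intro n
  induction n with
  | zero => exact fun _ => ⟨φ, t, List.prefix_rfl, hφ, Nat.zero_le _⟩
  | succ n ih =>
    intro hn
    obtain ⟨ψ, u, hle, hu, hr⟩ := ih (by omega)
    by_cases h : n + 1 ≤ (received c ψ).length
    · exact ⟨ψ, u, hle, hu, h⟩
    have h₁ := hu.length_sent c
    have h₂ := (sent_mono (c := c) (proj_mono hle _)).length_le
    obtain ⟨a, w, hw⟩ := List.exists_cons_of_length_pos (l := u.buf c) (by omega)
    obtain ⟨χ, v, hv, v', hv'⟩ := hE u ⟨ψ, hu⟩ c a w hw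
    refine ⟨_, v', hle.trans (List.prefix_append ..), hu.concat (hv.concat hv'), ?_⟩
    rw [received_append, received_append]
    simp [received] at hr ⊢
    omega

theorem exists_receive_all [Finite P] (hE : S.EventualReception ⊤) {t : Config P A Q}
    {φ : List (Action P A)} (hφ : S.Exec ⊤ S.initial φ t) :
    ∃ ψ u, φ <+: ψ ∧ S.Exec ⊤ S.initial ψ u ∧
      ∀ c, (sent c φ).length ≤ (received c ψ).length := by
  have : Finite (Channel P) := Finite.of_injective (fun c => (c.src, c.dst)) fun c d h => by
    ext <;> simp_all
  have := Fintype.ofFinite (Channel P)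
  suffices H : ∀ T : Finset (Channel P), ∃ ψ u, φ <+: ψ ∧ S.Exec ⊤ S.initial ψ u ∧
      ∀ c ∈ T, (sent c φ).length ≤ (received c ψ).length by
    simpa using H Finset.univ
  intro T
  induction T using Finset.induction_on with
  | empty => exact ⟨φ, t, List.prefix_rfl, hφ, by simp⟩
  | insert c T _ ih =>
    obtain ⟨ψ, u, hle, hu, hT⟩ := ih
    obtain ⟨ψ', u', hle', hu', hc⟩ := exists_received_ge hE hu c _ le_rfl
    refine ⟨ψ', u', hle.trans hle', hu', fun d hd => ?_⟩
    rcases Finset.mem_insert.1 hd with rfl | hd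
    · exact (sent_mono (proj_mono hle _)).length_le.trans hc
    · exact (hT d hd).trans (received_mono (proj_mono hle' _)).length_le

/-- An execution extends to an increasing chain of executions along which every message is
received. -/
theorem exists_fair_chain [Finite P] (hE : S.EventualReception ⊤) {t : Config P A Q}
    {φ : List (Action P A)} (hφ : S.Exec ⊤ S.initial φ t) :
    ∃ U : ℕ → List (Action P A), U 0 = φ ∧ (∀ n, ∃ u, S.Exec ⊤ S.initial (U n) u) ∧
      (∀ m n, m ≤ n → U m <+: U n) ∧
      ∀ n c, (sent c (U n)).length ≤ (received c (U (n + 1))).length := by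
  have step : ∀ x : {φ : List (Action P A) // ∃ u, S.Exec ⊤ S.initial φ u},
      ∃ y : {φ : List (Action P A) // ∃ u, S.Exec ⊤ S.initial φ u}, x.1 <+: y.1 ∧
        ∀ c, (sent c x.1).length ≤ (received c y.1).length := by
    rintro ⟨x, u, hu⟩
    obtain ⟨y, v, hle, hv, hr⟩ := exists_receive_all hE hu
    exact ⟨⟨y, v, hv⟩, hle, hr⟩
  choose F hF₁ hF₂ using step
  let V : ℕ → {φ : List (Action P A) // ∃ u, S.Exec ⊤ S.initial φ u} :=
    fun n => Nat.rec ⟨φ, t, hφ⟩ (fun _ x => F x) n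
  refine ⟨fun n => (V n).1, rfl, fun n => (V n).2, fun m n hmn => ?_, fun n => hF₂ (V n)⟩
  induction hmn with
  | refl => exact List.prefix_rfl
  | step _ ih => exact ih.trans (hF₁ _)

variable (S) in
/-- The `k`-bounded executions that extend `φ` without actions of `p` and stay below the
chain `U`. -/
def Follows (k : ℕ∞) (U : ℕ → List (Action P A)) (φ : List (Action P A)) (p : P)
    (x : List (Action P A)) : Prop :=
  φ <+: x ∧ proj p x = proj p φ ∧ (∃ u, S.Exec k S.initial x u) ∧
    ∃ n, ∀ q, proj q x <+: proj q (U n)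

/-- Both words lie below a common member of the chain, hence are compatible. Each projection of
their join is that of one of them, so `p` stays idle and the join stays below the chain. -/
theorem Follows.join (hS : S.IsCSA) {k : ℕ∞} {U : ℕ → List (Action P A)}
    (hU : ∀ m n, m ≤ n → U m <+: U n) {φ : List (Action P A)} {p : P} {x y : List (Action P A)}
    (hx : S.Follows k U φ p x) (hy : S.Follows k U φ p y) :
    ∃ z, S.Follows k U φ p z ∧ (∀ q, proj q x <+: proj q z) ∧ ∀ q, proj q y <+: proj q z := by
  obtain ⟨hφx, hpx, ⟨u, hu⟩, m, hm⟩ := hx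
  obtain ⟨hφy, hpy, ⟨v, hv⟩, n, hn⟩ := hy
  have hm' : ∀ q, proj q x <+: proj q (U (max m n)) :=
    fun q => (hm q).trans (proj_mono (hU _ _ (le_max_left ..)) q)
  have hn' : ∀ q, proj q y <+: proj q (U (max m n)) :=
    fun q => (hn q).trans (proj_mono (hU _ _ (le_max_right ..)) q)
  obtain ⟨z, w, hw, hxz, hz⟩ := hu.join hS hv (compatible_of_le hm' hn')
  refine ⟨z, ⟨hφx.trans hxz, ?_, ⟨w, hw⟩, max m n, fun q => ?_⟩, proj_mono hxz,
    fun q => (hz q).1⟩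
  · rcases (hz p).2 with h | h
    · exact h.trans hpx
    · exact h.trans hpy
  · rcases (hz q).2 with h | h
    · exact h ▸ hm' q
    · exact h ▸ hn' q

theorem Follows.join_family [Finite P] (hS : S.IsCSA) {k : ℕ∞} {U : ℕ → List (Action P A)}
    (hU : ∀ m n, m ≤ n → U m <+: U n) {φ : List (Action P A)} {p : P} {x : List (Action P A)}
    {y : P → List (Action P A)} (hx : S.Follows k U φ p x) (hy : ∀ r, S.Follows k U φ p (y r)) :
    ∃ z, S.Follows k U φ p z ∧ (∀ q, proj q x <+: proj q z) ∧
      ∀ r q, proj q (y r) <+: proj q z := by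
  have := Fintype.ofFinite P
  suffices H : ∀ T : Finset P, ∃ z, S.Follows k U φ p z ∧ (∀ q, proj q x <+: proj q z) ∧
      ∀ r ∈ T, ∀ q, proj q (y r) <+: proj q z by
    simpa using H Finset.univ
  intro T
  induction T using Finset.induction_on with
  | empty => exact ⟨x, hx, fun q => List.prefix_rfl, by simp⟩
  | insert r T _ ih =>
    obtain ⟨z, hz, hxz, hT⟩ := ih
    obtain ⟨z', hz', h₁, h₂⟩ := hz.join hS hU (hy r)
    refine ⟨z', hz', fun q => (hxz q).trans (h₁ q), fun r' hr' q => ?_⟩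
    rcases Finset.mem_insert.1 hr' with rfl | hr'
    · exact h₂ q
    · exact (hT r' hr' q).trans (h₁ q)

/-- Some word in a family that is closed under joins is maximal on every participant whose
number of actions is bounded. -/
theorem Follows.exists_maximal [Finite P] (hS : S.IsCSA) {k : ℕ∞} {U : ℕ → List (Action P A)}
    (hU : ∀ m n, m ≤ n → U m <+: U n) {φ : List (Action P A)} {p : P} {x : List (Action P A)}
    (hx : S.Follows k U φ p x) :
    ∃ z, S.Follows k U φ p z ∧ ∀ q,
      (∀ y, S.Follows k U φ p y → (proj q y).length ≤ (proj q z).length) ∨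
      ∀ m, ∃ y, S.Follows k U φ p y ∧ m ≤ (proj q y).length := by
  have H : ∀ q, ∃ z, S.Follows k U φ p z ∧
      ((∀ y, S.Follows k U φ p y → (proj q y).length ≤ (proj q z).length) ∨
      ∀ m, ∃ y, S.Follows k U φ p y ∧ m ≤ (proj q y).length) := by
    intro q
    by_cases h : BddAbove ((fun y => (proj q y).length) '' {y | S.Follows k U φ p y})
    · obtain ⟨z, hz, hzm⟩ := Nat.sSup_mem (Set.Nonempty.image _ ⟨x, hx⟩) h
      exact ⟨z, hz, .inl fun y hy => (le_csSup h ⟨y, hy, rfl⟩).trans_eq hzm.symm⟩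
    · refine ⟨x, hx, .inr fun m => ?_⟩
      by_contra! hm
      exact h ⟨m, by rintro _ ⟨y, hy, rfl⟩; exact (hm y hy).le⟩
  choose y hy hmax using H
  obtain ⟨z, hz, -, hyz⟩ := hx.join_family hS hU hy
  refine ⟨z, hz, fun q => (hmax q).imp_left fun h w hw => ?_⟩
  exact (h w hw).trans (hyz q q).length_le

theorem exhaustive_of_existBounded [Finite P] (hS : S.IsCSA) {k : ℕ} (hB : S.ExistBounded k)
    (hE : S.EventualReception ⊤) : S.Exhaustive k := by
  rintro s ⟨φ, hφ⟩ p hsend ℓ q' htr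
  have hsubj : ℓ.subj = p := (hS p).2.2 _ _ _ htr
  have hℓ := hsend.2 _ _ htr
  obtain ⟨t, ht⟩ : ∃ t, S.Exec ⊤ s [ℓ] t := by
    cases ℓ with
    | send c a => subst hsubj; exact hφ.mono.fire_send htr le_top
    | recv c a => exact hℓ.elim
  obtain ⟨U, hU₀, hUexec, hU, hUrec⟩ := exists_fair_chain hE (hφ.mono.concat ht)
  have hbase : S.Follows k U φ p φ := ⟨List.prefix_rfl, rfl, ⟨s, hφ⟩, 0, fun q => by
    rw [hU₀]; exact proj_mono (List.prefix_append ..) q⟩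
  obtain ⟨x, hx, hmax⟩ := hbase.exists_maximal hS hU
  -- Since there are finitely many participants, one index `n` witnesses every participant that the
  -- chain ever takes beyond `x`.
  obtain ⟨n, hn⟩ : ∃ n, ∀ q, (∃ m, (proj q x).length < (proj q (U m)).length) →
      (proj q x).length < (proj q (U n)).length := by
    have := Fintype.ofFinite P
    have H : ∀ q, ∃ n, (∃ m, (proj q x).length < (proj q (U m)).length) →
        (proj q x).length < (proj q (U n)).length := fun q => by
      by_cases h : ∃ m, (proj q x).length < (proj q (U m)).length
      · obtain ⟨m, hm⟩ := h
        exact ⟨m, fun _ => hm⟩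
      · exact ⟨0, fun h' => absurd h' h⟩
    choose N hN using H
    refine ⟨Finset.univ.sup N, fun q hq => (hN q hq).trans_le ?_⟩
    exact (proj_mono (hU _ _ (Finset.le_sup (Finset.mem_univ q))) q).length_le
  -- Participants with unbounded progress are pushed past `U (n + 1)`, so an action of `U (n + 1)`
  -- missing from `z` belongs to one on which `x` is maximal.
  obtain ⟨z, hz, hxz, hzU⟩ : ∃ z, S.Follows k U φ p z ∧ (∀ q, proj q x <+: proj q z) ∧
      ∀ q, (∀ y, S.Follows k U φ p y → (proj q y).length ≤ (proj q x).length) ∨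
        (proj q (U (n + 1))).length ≤ (proj q z).length := by
    have H : ∀ q, ∃ y, S.Follows k U φ p y ∧
        ((∀ y, S.Follows k U φ p y → (proj q y).length ≤ (proj q x).length) ∨
          (proj q (U (n + 1))).length ≤ (proj q y).length) := fun q => by
      rcases hmax q with h | h
      · exact ⟨x, hx, .inl h⟩
      · obtain ⟨y, hy, hm⟩ := h (proj q (U (n + 1))).length
        exact ⟨y, hy, .inr hm⟩
    choose y hy hyU using H
    obtain ⟨z, hz, h₁, h₂⟩ := hx.join_family hS hU hy
    exact ⟨z, hz, h₁, fun q => (hyU q).imp_right fun h => h.trans (h₂ q q).length_le⟩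
  obtain ⟨hφz, hpz, ⟨u, hu⟩, j, hj⟩ := id hz
  obtain ⟨v, hv⟩ := hUexec (n + 1)
  obtain ⟨ψ, ⟨-, hψ, hproj⟩, -, hbd⟩ := hB _ _ hv
  obtain ⟨v', hv'⟩ := hv.of_valid hS hψ fun q => (hproj q) ▸ List.prefix_rfl
  have hcomp : Compatible ψ z := fun q => by
    rw [← hproj q]
    refine List.prefix_or_prefix_of_prefix (l₃ := proj q (U (max (n + 1) j))) ?_ ?_
    · exact proj_mono (hU _ _ (le_max_left ..)) q
    · exact (hj q).trans (proj_mono (hU _ _ (le_max_right ..)) q)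
  have hpU : proj p φ ++ [ℓ] <+: proj p (U (n + 1)) := by
    rw [← hsubj, ← proj_concat_self, ← hU₀]
    exact proj_mono (hU _ _ (Nat.zero_le _)) _
  -- All of `ψ` cannot be below `z`, because `ψ` contains the action `ℓ` of `p` and `z` does not.
  rcases hcomp.le_or_exists_first with hle | ⟨ψ₁, e, ψ₂, rfl, hle, heq⟩
  · have := (hpU.trans ((hproj p).symm ▸ hle p)).length_le
    rw [hpz] at this
    simp at this
  have hpre : ψ₁ ++ [e] <+: ψ₁ ++ e :: ψ₂ := ⟨ψ₂, by simp⟩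
  have hzeU : proj e.subj (z ++ [e]) <+: proj e.subj (U (n + 1)) := by
    rw [proj_concat_self, ← heq, ← proj_concat_self, hproj]
    exact proj_mono hpre _
  have hlen := hzeU.length_le
  rw [proj_concat_self, List.length_append, List.length_singleton] at hlen
  have hbound := (hzU e.subj).resolve_right (by omega)
  have hxz' := hxz e.subj
  have hlenx : (proj e.subj z).length = (proj e.subj x).length :=
    le_antisymm (hbound z hz) hxz'.length_le
  -- The subject of `e` has not moved beyond `x`, and the choice of `n` puts its next action already
  -- in `U n`.
  have hzeUn : proj e.subj (z ++ [e]) <+: proj e.subj (U n) := by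
    refine List.prefix_of_prefix_length_le hzeU (proj_mono (hU _ _ (Nat.le_succ n)) _) ?_
    have := hn e.subj ⟨n + 1, by omega⟩
    rw [proj_concat_self, List.length_append, List.length_singleton]
    omega
  obtain ⟨w, hw⟩ := hv'.of_prefix hpre
  -- A send in `U n` is received in `U (n + 1)`. Hence the minimum in the match bound is the number
  -- of sends, and the bound limits the actual queue length.
  obtain ⟨t', ht'⟩ : ∃ t', S.Exec k u [e] t' := by
    refine hu.fire_of_le hS hw hle heq fun c a he => ?_
    subst he
    have h₁ := hbd _ hpre c
    have h₂ : received c (ψ₁ ++ .send c a :: ψ₂) = received c (U (n + 1)) :=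
      received_congr (hproj _).symm
    have h₃ := hUrec n c
    have h₄ := (sent_mono (c := c) hzeUn).length_le
    have h₅ : sent c ψ₁ = sent c z := sent_congr heq
    have h₆ : (sent c (ψ₁ ++ [.send c a])).length = (sent c ψ₁).length + 1 := by
      simp [sent]
    have h₇ : received c (ψ₁ ++ [.send c a]) = received c ψ₁ := by simp [received]
    have h₈ : (sent c (z ++ [.send c a])).length = (sent c z).length + 1 := by
      simp [sent]
    rw [h₂, h₆, h₇] at h₁
    rw [h₈, ← h₅] at h₄
    have : (sent c ψ₁).length + 1 ≤ (received c ψ₁).length + k := by omega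
    exact_mod_cast this
  by_cases hep : e.subj = p
  · obtain rfl : e = ℓ := by
      have h := hzeU
      rw [proj_concat_self, hep, hpz] at h
      have := List.prefix_of_prefix_length_le h hpU (by simp)
      simpa using this
    obtain ⟨χ, rfl⟩ := hφz
    obtain ⟨s', hs', hχ⟩ := exec_append.1 hu
    obtain rfl := hs'.unique hS hφ
    refine ⟨χ, u, hχ, fun ℓ' hℓ' hp' => ?_, t', ht'⟩
    rw [proj_append] at hpz
    replace hpz := List.append_right_eq_self.1 hpz
    exact List.filter_eq_nil_iff.1 hpz ℓ' hℓ' (by simpa using hp')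
  -- If `e` is not an action of `p`, then `z ++ [e]` contradicts maximality on its subject.
  · have hfol : S.Follows k U φ p (z ++ [e]) := by
      refine ⟨hφz.trans (List.prefix_append ..), by rw [proj_concat_of_ne _ hep, hpz],
        ⟨t', hu.concat ht'⟩, max n j, fun q => ?_⟩
      by_cases hq : e.subj = q
      · subst hq
        exact hzeUn.trans (proj_mono (hU _ _ (le_max_left ..)) _)
      · rw [proj_concat_of_ne _ hq]
        exact (hj q).trans (proj_mono (hU _ _ (le_max_right ..)) _)
    have := hbound _ hfol
    rw [proj_concat_self, List.length_append, List.length_singleton] at this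
    omega

end System

end Communicating

theorem mainTheorem3 {P A : Type*} [Finite P] [DecidableEq P] [Finite A]
    {Q : P → Type*} [∀ p, Finite (Q p)]
    (S : Communicating.System P A Q) (hS : Communicating.System.IsCSA S)
    (k : ℕ) (hk : 0 < k) :
    (Communicating.System.OBI S k → Communicating.System.IBI S ⊤ →
      Communicating.System.Exhaustive S k → Communicating.System.ExistBounded S k) ∧
    (Communicating.System.ExistBounded S k → Communicating.System.EventualReception S ⊤ →
      Communicating.System.Exhaustive S k) :=
  ⟨Communicating.System.existBounded_of_exhaustive hS,
    Communicating.System.exhaustive_of_existBounded hS⟩
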